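/- **Theorem 1.3 (Generalized Nayar's theorem).** Let $G$ be a finitely generated abelian group, written as an internal direct sum $G=G_1\oplus G_2$ with $G_1\cong\mathbb Z^m$ and $G_2\cong\bigoplus_{i=1}^l\mathbb Z_{q_i}$, where each $q_i$ is a power of a prime, and let $\pi_{G_1}:G\to G_1$, $x_1+x_2\mapsto x_1$ (for $x_i\in G_i$), be the projection. Let $S$ be a finite symmetric generating multiset of $G$ (that is, $S=-S$ with multiplicities; repeated elements and $0\in S$ are allowed), and let $\pi_{G_1}S$ be its image, with multiplicities, a generating multiset of $G_1$. For $u:G\to\mathbb R$ put $L^Su(x)=\sum_{s\in S}(u(x+s)-u(x))$ (sum with multiplicity), and let $d^S$ be the word metric, $d^S(x,y)$ being the least length of a path $x=x_0,x_1,\dots,x_k=y$ with $x_{j+1}-x_j\in S$. For real $d\ge 0$ and a base point $p\in G$ put $$H^d(G,S)=\{u:G\to\mathbb R \mid L^Su=0,\ \exists C\ \forall x:\ |u(x)|\le C(d^S(p,x)+1)^d\},$$ $$HM^d(G,S)=\operatorname{Span}_{\mathbb R}\{u:G\to\mathbb R \mid L^Su=0,\ \exists C\ \forall x:\ u(x)\ge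 -C(d^S(p,x)+1)^d\},$$ and define $H^d(G_1,\pi_{G_1}S)$ in the same way, with a base point $p_1\in G_1$. Then, for every real $d\ge 0$ and all base points $p\in G$, $p_1\in G_1$, $$HM^d(G,S)=H^d(G,S)=H^d(G_1,\pi_{G_1}S),$$ where a function $g$ on $G_1$ is identified with the function $g\circ\pi_{G_1}$ on $G$; that is, $H^d(G,S)=\{g\circ\pi_{G_1}\mid g\in H^d(G_1,\pi_{G_1}S)\}$. -/

import Mathlib

/-! Harmonic functions on Cayley graphs of abelian groups. The generating family `S` is a multiset:
repeated elements produce multiple edges and `0 ∈ S` produces self-loops. -/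

namespace AbelianCayley

/-- `S` is a symmetric (finite) generating multiset of the abelian group `G`: `S = -S` with
multiplicities, and `S` generates `G`. -/
structure IsSymmGen {G : Type*} [AddCommGroup G] (S : Multiset G) : Prop where
  symm : S.map (fun s => -s) = S
  gen : AddSubgroup.closure {s : G | s ∈ S} = ⊤

/-- Adjacency in the Cayley graph: `x ∼ y` iff `y - x ∈ S`. -/
def Adj {G : Type*} [AddCommGroup G] (S : Multiset G) (x y : G) : Prop :=
  y - x ∈ S

/-- The word metric: the least `k` such that there is a path `x = c 0 ∼ c 1 ∼ ⋯ ∼ c k = y`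
(such a path exists when `S` is a symmetric generating multiset). -/
noncomputable def wordDist {G : Type*} [AddCommGroup G] (S : Multiset G) (x y : G) : ℕ :=
  sInf {k : ℕ | ∃ c : ℕ → G, c 0 = x ∧ c k = y ∧ ∀ i < k, Adj S (c i) (c (i + 1))}

/-- The discrete Laplacian `L^S u (x) = ∑_{y ∼ x} (u y - u x)`, edges counted with multiplicity,
i.e. the sum over `s ∈ S` with multiplicity of `u (x + s) - u x`. -/
def laplacian {G : Type*} [AddCommGroup G] (S : Multiset G) (u : G → ℝ) (x : G) : ℝ :=
  (S.map (fun s => u (x + s) - u x)).sum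

/-- `u` is discrete harmonic on the Cayley graph `(G, S)`. -/
def IsHarmonic {G : Type*} [AddCommGroup G] (S : Multiset G) (u : G → ℝ) : Prop :=
  ∀ x, laplacian S u x = 0

/-- The space `H^d(G, S)` of harmonic functions with `|u x| ≤ C (d^S(p, x) + 1) ^ d` for some `C`,
where `p` is the base point. -/
def H {G : Type*} [AddCommGroup G] (S : Multiset G) (p : G) (d : ℝ) : Submodule ℝ (G → ℝ) where
  carrier := {u | IsHarmonic S u ∧
    ∃ C : ℝ, ∀ x, |u x| ≤ C * ((wordDist S p x : ℝ) + 1) ^ d}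
  zero_mem' := ⟨fun x => by simp [laplacian], 0, fun x => by simp⟩
  add_mem' := by
    rintro u v ⟨hu, C, hC⟩ ⟨hv, D, hD⟩
    refine ⟨fun x => ?_, C + D, fun x => ?_⟩
    · have h : laplacian S (u + v) x = laplacian S u x + laplacian S v x := by
        simp only [laplacian, ← Multiset.sum_map_add, Pi.add_apply]
        congr 2
        funext s
        ring
      rw [h, hu x, hv x, add_zero]
    · have h := abs_add_le (u x) (v x)
      have h1 := hC x
      have h2 := hD x
      rw [Pi.add_apply, add_mul]
      linarith
  smul_mem' := by
    rintro c u ⟨hu, C, hC⟩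
    refine ⟨fun x => ?_, |c| * C, fun x => ?_⟩
    · have h : laplacian S (c • u) x = c * laplacian S u x := by
        simp only [laplacian, ← Multiset.sum_map_mul_left, Pi.smul_apply, smul_eq_mul, mul_sub]
      rw [h, hu x, mul_zero]
    · rw [Pi.smul_apply, smul_eq_mul, abs_mul, mul_assoc]
      exact mul_le_mul_of_nonneg_left (hC x) (abs_nonneg c)

/-- The space `HM^d(G, S)`: the linear span of the harmonic functions that satisfy only the
one-sided bound `u x ≥ -C (d^S(p, x) + 1) ^ d` for some `C`. -/
def HM {G : Type*} [AddCommGroup G] (S : Multiset G) (p : G) (d : ℝ) : Submodule ℝ (G → ℝ) :=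
  Submodule.span ℝ {u | IsHarmonic S u ∧
    ∃ C : ℝ, ∀ x, -C * ((wordDist S p x : ℝ) + 1) ^ d ≤ u x}

/-- The projection `π_{G₁} : G → G₁` of an internal direct sum `G = G₁ ⊕ G₂`,
`x₁ + x₂ ↦ x₁`. -/
noncomputable def proj {G : Type*} [AddCommGroup G] {G₁ G₂ : Submodule ℤ G}
    (h : IsCompl G₁ G₂) : G →ₗ[ℤ] G₁ :=
  G₁.projectionOnto G₂ h

end AbelianCayley

/-!
Let `X n` be the random walk on `G` whose steps are drawn uniformly from a list containing `0` once
and every `s ∈ S` twice, and let `z k` be the number of times the `k`-th step `a k` has been used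
up to time `n`. If `u` is harmonic then `n (u (x + a k) - u x) = N 𝔼[(z k - z o) u (x + X n)]`,
where `N` is the number of steps and `a o = 0`. The deviations `z k - z o` are of order `√n`, with
subgaussian tails.

A harmonic `u ≥ -C (|x| + 1) ^ d` satisfies
`𝔼|u (x + X n)| ≤ u x + 2 𝔼 u⁻(x + X n) = O(n ^ (d / 2))`, and by the identity above each
difference of `u` lowers this exponent by almost `1 / 2`. After `⌊d⌋ + 1` differences it is
negative, so the difference vanishes: `u` is a polynomial map of degree at most `d`. Polynomial
maps are invariant under torsion and of growth `|x| ^ ⌊d⌋`.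

To discard the large deviations one needs some polynomial bound on `u` beforehand. It comes from
the mean growth, as a point of length `L` is hit at a time of order `L ^ 2` with probability at
least `L ^ (-O(1))`.
-/

open Filter Topology Asymptotics

namespace AbelianCayley

section StepAverage

variable {κ M M' : Type*} [Fintype κ] [AddCommMonoid M] [AddCommMonoid M']

/-- The Markov operator of the random walk on `M` whose steps are drawn uniformly from the family
`a`. -/
noncomputable def stepAvg (a : κ → M) : Module.End ℝ (M → ℝ) :=
  (Fintype.card κ : ℝ)⁻¹ • ∑ k, LinearMap.funLeft ℝ ℝ (· + a k)

theorem stepAvg_apply (a : κ → M) (F : M → ℝ) (x : M) :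
    stepAvg a F x = (Fintype.card κ : ℝ)⁻¹ * ∑ k, F (x + a k) := by
  simp [stepAvg, LinearMap.sum_apply, Finset.sum_apply, LinearMap.funLeft_apply]

theorem stepAvg_pow_succ_apply (a : κ → M) (n : ℕ) (F : M → ℝ) (x : M) :
    (stepAvg a ^ (n + 1)) F x =
      (Fintype.card κ : ℝ)⁻¹ * ∑ k, (stepAvg a ^ n) F (x + a k) := by
  rw [pow_succ', Module.End.mul_apply, stepAvg_apply]

theorem stepAvg_pow_mono (a : κ → M) (n : ℕ) : Monotone (stepAvg a ^ n) := by
  intro F F' h x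
  induction n generalizing x with
  | zero => exact h x
  | succ n ih =>
    rw [stepAvg_pow_succ_apply, stepAvg_pow_succ_apply]
    gcongr with k
    exact ih _

theorem stepAvg_pow_nonneg (a : κ → M) (n : ℕ) {F : M → ℝ} (hF : 0 ≤ F) :
    0 ≤ (stepAvg a ^ n) F := by
  simpa using stepAvg_pow_mono a n hF

theorem stepAvg_pow_eq_self {a : κ → M} {F : M → ℝ} (h : stepAvg a F = F) (n : ℕ) :
    (stepAvg a ^ n) F = F := by
  rw [Module.End.pow_apply, Function.iterate_fixed h]

theorem abs_stepAvg_pow_le (a : κ → M) (n : ℕ) (F : M → ℝ) :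
    |(stepAvg a ^ n) F| ≤ (stepAvg a ^ n) |F| :=
  abs_le'.2 ⟨stepAvg_pow_mono a n (le_abs_self F), by
    simpa using stepAvg_pow_mono a n (neg_le_abs F)⟩

theorem stepAvg_comp_add (a : κ → M) (φ : M →+ M') (x : M') (F : M' → ℝ) :
    stepAvg a (fun z => F (x + φ z)) = fun z => stepAvg (φ ∘ a) F (x + φ z) := by
  funext z
  simp [stepAvg_apply, add_assoc]

theorem stepAvg_pow_comp_add (a : κ → M) (φ : M →+ M') (x : M') (n : ℕ) (F : M' → ℝ) :
    (stepAvg a ^ n) (fun z => F (x + φ z)) = fun z => (stepAvg (φ ∘ a) ^ n) F (x + φ z) := by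
  induction n with
  | zero => rfl
  | succ n ih => simp only [pow_succ', Module.End.mul_apply, ih, stepAvg_comp_add]

theorem stepAvg_fwdDiff_eq {a : κ → M} {u : M → ℝ}
    (hu : stepAvg a u = u) (g : M) : stepAvg a (fwdDiff g u) = fwdDiff g u := by
  funext x
  have h y : (Fintype.card κ : ℝ)⁻¹ * ∑ k, u (y + a k) = u y := by
    rw [← stepAvg_apply, hu]
  simp only [stepAvg_apply, fwdDiff, Finset.sum_sub_distrib, mul_sub, h, add_right_comm _ _ g]

/-- The mean over all words of length `n` in the alphabet `κ` of a function of the letter counts. -/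
noncomputable def countMean [DecidableEq κ] (n : ℕ) : ((κ → ℕ) → ℝ) →ₗ[ℝ] ℝ :=
  LinearMap.proj 0 ∘ₗ stepAvg (fun k : κ => Pi.single k 1) ^ n

end StepAverage

section CountDiff

variable {κ : Type*}

/-- The difference of the counts of the letters `k` and `l`, as an additive character. -/
def countDiff (k l : κ) : (κ → ℕ) →+ ℝ :=
  (Nat.castAddMonoidHom ℝ).comp (Pi.evalAddMonoidHom _ k) -
    (Nat.castAddMonoidHom ℝ).comp (Pi.evalAddMonoidHom _ l)

theorem countDiff_apply (k l : κ) (z : κ → ℕ) : countDiff k l z = z k - z l := rfl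

theorem countDiff_single [DecidableEq κ] (k l j : κ) :
    countDiff k l (Pi.single j 1) = (if j = k then 1 else 0) - if j = l then 1 else 0 := by
  simp [countDiff_apply, Pi.single_apply, eq_comm]

end CountDiff

section Spread

variable {κ : Type*} [Fintype κ]

/-- The total deviation of the letter counts `z` from the count of the letter `o`. -/
noncomputable def spread (o : κ) (z : κ → ℕ) : ℝ :=
  ∑ k, |countDiff k o z|

theorem abs_countDiff_le_spread (o k : κ) (z : κ → ℕ) : |countDiff k o z| ≤ spread o z :=
  Finset.single_le_sum (f := fun k => |countDiff k o z|) (fun _ _ => abs_nonneg _)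
    (Finset.mem_univ k)

theorem spread_nonneg (o : κ) (z : κ → ℕ) : 0 ≤ spread o z :=
  Finset.sum_nonneg fun _ _ => abs_nonneg _

theorem exp_spread_le (o : κ) {θ : ℝ} (hθ : 0 ≤ θ) (z : κ → ℕ) :
    Real.exp (θ * spread o z) ≤ ∑ k, 2 * Real.cosh (θ * Fintype.card κ * countDiff k o z) := by
  obtain ⟨k, -, hk⟩ := Finset.exists_max_image Finset.univ (fun k => |countDiff k o z|)
    ⟨o, Finset.mem_univ o⟩
  have hspread : spread o z ≤ Fintype.card κ * |countDiff k o z| := by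
    simpa [spread] using Finset.sum_le_card_nsmul _ _ _ hk
  calc Real.exp (θ * spread o z)
      ≤ Real.exp |θ * Fintype.card κ * countDiff k o z| := by
        rw [abs_mul, abs_of_nonneg (by positivity), mul_assoc]
        gcongr
    _ ≤ 2 * Real.cosh (θ * Fintype.card κ * countDiff k o z) := by
        rw [Real.cosh_eq]
        linarith [Real.exp_abs_le (θ * Fintype.card κ * countDiff k o z)]
    _ ≤ ∑ k, 2 * Real.cosh (θ * Fintype.card κ * countDiff k o z) :=
        Finset.single_le_sum (f := fun k => 2 * Real.cosh (θ * Fintype.card κ * countDiff k o z))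
          (fun k _ => by positivity)
          (Finset.mem_univ k)

theorem one_add_rpow_le_sqrt_mul_exp {p : ℝ} (hp : 0 ≤ p) {n : ℕ} (hn : 1 ≤ n) {t : ℝ}
    (ht : 0 ≤ t) : (1 + t) ^ p ≤ (n : ℝ) ^ (p / 2) * Real.exp (p / √n * t) := by
  have hsqrt : 1 ≤ √(n : ℝ) := Real.one_le_sqrt.2 (by exact_mod_cast hn)
  calc (1 + t) ^ p ≤ (√n * Real.exp (t / √n)) ^ p := by
        gcongr
        calc 1 + t ≤ √n * (t / √n + 1) := by
              rw [mul_add, mul_div_cancel₀ _ (by positivity)]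
              linarith
          _ ≤ √n * Real.exp (t / √n) := by
              gcongr
              exact Real.add_one_le_exp _
    _ = (n : ℝ) ^ (p / 2) * Real.exp (p / √n * t) := by
        rw [Real.mul_rpow (by positivity) (by positivity), ← Real.exp_mul,
          Real.sqrt_eq_rpow, ← Real.rpow_mul (by positivity)]
        ring_nf

end Spread

section CountMean

variable {κ : Type*} [Fintype κ] [DecidableEq κ]

theorem countMean_mono (n : ℕ) : Monotone (countMean (κ := κ) n) :=
  fun _ _ h => stepAvg_pow_mono _ n h 0

theorem abs_countMean_le (n : ℕ) (F : (κ → ℕ) → ℝ) : |countMean n F| ≤ countMean n |F| :=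
  abs_stepAvg_pow_le _ n F 0

theorem linearCombination_comp_single {M : Type*} [AddCommMonoid M] (a : κ → M) :
    (Fintype.linearCombination ℕ a).toAddMonoidHom ∘ (fun k : κ => Pi.single k 1) = a :=
  funext fun k => by simp [Fintype.linearCombination_apply_single]

theorem stepAvg_pow_apply_eq_countMean {M : Type*} [AddCommMonoid M] (a : κ → M) (n : ℕ)
    (F : M → ℝ) (x : M) :
    (stepAvg a ^ n) F x = countMean n fun z => F (x + Fintype.linearCombination ℕ a z) := by
  have h := congrFun (stepAvg_pow_comp_add (fun k : κ => Pi.single k 1)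
    (Fintype.linearCombination ℕ a).toAddMonoidHom x n F) 0
  rw [linearCombination_comp_single, map_zero, add_zero] at h
  exact h.symm

theorem stepAvg_countDiff_mul {v : (κ → ℕ) → ℝ}
    (hv : stepAvg (fun j : κ => Pi.single j 1) v = v) (k l : κ) :
    stepAvg (fun j : κ => Pi.single j 1) (⇑(countDiff k l) * v) =
      ⇑(countDiff k l) * v + (Fintype.card κ : ℝ)⁻¹ •
        (fwdDiff (Pi.single k 1) v - fwdDiff (Pi.single l 1) v) := by
  funext z
  have hz := congrFun hv z
  rw [stepAvg_apply] at hz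
  simp only [stepAvg_apply, Pi.mul_apply, Pi.add_apply, Pi.smul_apply, Pi.sub_apply, map_add,
    add_mul, countDiff_single, sub_mul, ite_mul, one_mul, zero_mul, Finset.sum_add_distrib,
    Finset.sum_sub_distrib, Finset.sum_ite_eq', Finset.mem_univ, if_true, ← Finset.mul_sum,
    smul_eq_mul, fwdDiff]
  rw [mul_add, mul_left_comm, hz]
  ring

/-- Integration by parts for the random walk. -/
theorem card_mul_countMean_countDiff_mul {v : (κ → ℕ) → ℝ}
    (hv : stepAvg (fun j : κ => Pi.single j 1) v = v) (k l : κ) (n : ℕ) :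
    Fintype.card κ * countMean n (⇑(countDiff k l) * v) =
      n * (v (Pi.single k 1) - v (Pi.single l 1)) := by
  have hcard : (Fintype.card κ : ℝ) ≠ 0 := by
    have : Nonempty κ := ⟨k⟩
    simp
  set g := fwdDiff (Pi.single k 1) v - fwdDiff (Pi.single l 1) v with hg
  have hpow : (stepAvg (fun j : κ => Pi.single j 1) ^ n) (⇑(countDiff k l) * v) =
      ⇑(countDiff k l) * v + (n * (Fintype.card κ : ℝ)⁻¹) • g := by
    induction n with
    | zero => simp
    | succ n ih =>
      have hgfix : stepAvg (fun j : κ => Pi.single j 1) g = g := by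
        rw [hg, map_sub, stepAvg_fwdDiff_eq hv, stepAvg_fwdDiff_eq hv]
      rw [pow_succ', Module.End.mul_apply, ih, map_add, map_smul, hgfix,
        stepAvg_countDiff_mul hv, Nat.cast_succ]
      module
  have hzero := congrFun hpow 0
  simp only [Pi.add_apply, Pi.mul_apply, map_zero, zero_mul, zero_add, Pi.smul_apply, smul_eq_mul,
    hg, Pi.sub_apply, fwdDiff, sub_sub_sub_cancel_right] at hzero
  rw [countMean, LinearMap.comp_apply, LinearMap.proj_apply, hzero]
  field_simp

theorem card_mul_countMean_countDiff_mul_comp {M : Type*} [AddCommMonoid M] {a : κ → M}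
    {u : M → ℝ} (hu : stepAvg a u = u) (k l : κ) (n : ℕ) (x : M) :
    Fintype.card κ * countMean n
        (⇑(countDiff k l) * fun z => u (x + Fintype.linearCombination ℕ a z)) =
      n * (u (x + a k) - u (x + a l)) := by
  have hlift := stepAvg_comp_add (fun j : κ => Pi.single j 1)
    (Fintype.linearCombination ℕ a).toAddMonoidHom x u
  rw [linearCombination_comp_single, hu] at hlift
  simpa [Fintype.linearCombination_apply_single] using
    card_mul_countMean_countDiff_mul hlift k l n

theorem stepAvg_cosh_countDiff_le (k l : κ) (θ : ℝ) :
    stepAvg (fun j : κ => Pi.single j 1) (fun z => Real.cosh (θ * countDiff k l z)) ≤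
      Real.cosh θ • fun z => Real.cosh (θ * countDiff k l z) := by
  intro z
  have hcard : (Fintype.card κ : ℝ) ≠ 0 := by
    have : Nonempty κ := ⟨k⟩
    simp
  have hcosh (j : κ) : Real.cosh (θ * countDiff k l (z + Pi.single j 1)) ≤
      Real.cosh θ * Real.cosh (θ * countDiff k l z) +
        Real.sinh (θ * countDiff k l z) * Real.sinh θ * countDiff k l (Pi.single j 1) := by
    simp only [map_add, mul_add, Real.cosh_add, countDiff_single]
    have h₁ := Real.one_le_cosh θ
    have h₂ := Real.cosh_pos (θ * countDiff k l z)
    split_ifs <;> simp <;> nlinarith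
  have hsum : ∑ j, countDiff k l (Pi.single j 1) = 0 := by
    simp [countDiff_single]
  rw [stepAvg_apply, Pi.smul_apply, smul_eq_mul, inv_mul_le_iff₀ (by positivity)]
  calc ∑ j, Real.cosh (θ * countDiff k l (z + Pi.single j 1))
      ≤ ∑ j, (Real.cosh θ * Real.cosh (θ * countDiff k l z) +
          Real.sinh (θ * countDiff k l z) * Real.sinh θ * countDiff k l (Pi.single j 1)) :=
        Finset.sum_le_sum fun j _ => hcosh j
    _ = Fintype.card κ * (Real.cosh θ * Real.cosh (θ * countDiff k l z)) := by
        rw [Finset.sum_add_distrib, ← Finset.mul_sum _ fun j => countDiff k l (Pi.single j 1), hsum]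
        simp

theorem countMean_cosh_countDiff_le (k l : κ) (θ : ℝ) (n : ℕ) :
    countMean n (fun z => Real.cosh (θ * countDiff k l z)) ≤ Real.exp (n * (θ ^ 2 / 2)) := by
  have hpow : (stepAvg (fun j : κ => Pi.single j 1) ^ n)
      (fun z => Real.cosh (θ * countDiff k l z)) ≤
        Real.cosh θ ^ n • fun z => Real.cosh (θ * countDiff k l z) := by
    induction n with
    | zero => simp
    | succ n ih =>
      rw [pow_succ, Module.End.mul_apply, pow_succ', mul_smul]
      refine (stepAvg_pow_mono _ n (stepAvg_cosh_countDiff_le k l θ)).trans ?_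
      rw [map_smul]
      exact smul_le_smul_of_nonneg_left ih (Real.cosh_pos θ).le
  calc countMean n (fun z => Real.cosh (θ * countDiff k l z))
      ≤ Real.cosh θ ^ n := by simpa [countMean] using hpow 0
    _ ≤ Real.exp (θ ^ 2 / 2) ^ n := by
        gcongr
        exact Real.cosh_le_exp_half_sq θ
    _ = Real.exp (n * (θ ^ 2 / 2)) := (Real.exp_nat_mul _ n).symm

theorem countMean_spread_rpow_le (o : κ) {p : ℝ} (hp : 0 ≤ p) :
    ∃ C, 0 ≤ C ∧ ∀ n : ℕ, 1 ≤ n →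
      countMean n (fun z => (1 + spread o z) ^ p) ≤ C * (n : ℝ) ^ (p / 2) := by
  set N : ℝ := (Fintype.card κ : ℝ)
  refine ⟨N * (2 * Real.exp ((p * N) ^ 2 / 2)), by positivity, fun n hn => ?_⟩
  have hn0 : (0 : ℝ) < n := by exact_mod_cast hn
  have hpoint : (fun z => (1 + spread o z) ^ p) ≤
      (n : ℝ) ^ (p / 2) • ∑ k, (2 : ℝ) • fun z => Real.cosh (p / √n * N * countDiff k o z) := by
    intro z
    have h := (one_add_rpow_le_sqrt_mul_exp hp hn (spread_nonneg o z)).trans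
      (mul_le_mul_of_nonneg_left (exp_spread_le o (by positivity) z) (by positivity))
    simpa [Finset.sum_apply] using h
  refine (countMean_mono n hpoint).trans ?_
  simp only [map_smul, map_sum, smul_eq_mul]
  rw [mul_comm]
  gcongr
  calc ∑ k, 2 * countMean n (fun z => Real.cosh (p / √n * N * countDiff k o z))
      ≤ ∑ _k : κ, 2 * Real.exp (n * ((p / √n * N) ^ 2 / 2)) := by
        gcongr with k
        exact countMean_cosh_countDiff_le k o _ n
    _ = N * (2 * Real.exp ((p * N) ^ 2 / 2)) := by
        have : n * ((p / √n * N) ^ 2 / 2) = (p * N) ^ 2 / 2 := by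
          field_simp
          rw [Real.sq_sqrt hn0.le]
          ring
        simp [this, N]

end CountMean

section Multinomial

variable {κ M : Type*} [Fintype κ] [AddCommMonoid M]

theorem prod_factorial_add_single [DecidableEq κ] (w : κ → ℕ) (k : κ) :
    ∏ j, ((w + Pi.single k 1 : κ → ℕ) j).factorial = (w k + 1) * ∏ j, (w j).factorial := by
  have hfactor (j : κ) : ((w + Pi.single k 1 : κ → ℕ) j).factorial =
      (if j = k then w k + 1 else 1) * (w j).factorial := by
    by_cases h : j = k
    · subst h; simp [Nat.factorial_succ]
    · simp [h]
  simp only [hfactor, Finset.prod_mul_distrib, Finset.prod_ite_eq', Finset.mem_univ, if_true]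

/-- If `F` is the indicator of a point, this is the multinomial lower bound for the probability that
the walk hits this point. -/
theorem factorial_mul_le_stepAvg_pow (a : κ → M) {F : M → ℝ} (hF : 0 ≤ F) (z : κ → ℕ) (x : M) :
    (∑ k, z k).factorial * F (x + ∑ k, z k • a k) ≤
      (∏ k, (z k).factorial : ℕ) * (Fintype.card κ : ℝ) ^ (∑ k, z k) *
        (stepAvg a ^ (∑ k, z k)) F x := by
  classical
  induction hn : ∑ k, z k generalizing z x with
  | zero =>
    have hz : z = 0 := funext fun k => by simpa using Finset.sum_eq_zero_iff.1 hn k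
    simp [hz]
  | succ n ih =>
    have hcard : (Fintype.card κ : ℝ) ≠ 0 := by
      have : Nonempty κ := by
        by_contra h
        simp [not_nonempty_iff.1 h] at hn
      simp
    have hletter (k : κ) : z k * (n.factorial * F (x + ∑ j, z j • a j)) ≤
        (∏ j, (z j).factorial : ℕ) * (Fintype.card κ : ℝ) ^ n * (stepAvg a ^ n) F (x + a k) := by
      rcases Nat.eq_zero_or_pos (z k) with hk | hk
      · rw [hk, Nat.cast_zero, zero_mul]
        exact mul_nonneg (by positivity) (stepAvg_pow_nonneg a n hF _)
      · obtain ⟨w, rfl⟩ : ∃ w : κ → ℕ, z = w + Pi.single k 1 := by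
          refine ⟨z - Pi.single k 1, (tsub_add_cancel_of_le fun j => ?_).symm⟩
          by_cases h : j = k
          · subst h; simpa [Nat.one_le_iff_ne_zero] using hk.ne'
          · simp [h]
        have hw : ∑ j, w j = n := by simpa [Finset.sum_add_distrib] using hn
        have hend : x + ∑ j, (w + Pi.single k 1 : κ → ℕ) j • a j = x + a k + ∑ j, w j • a j := by
          simp [add_smul, Finset.sum_add_distrib, Pi.single_apply, add_assoc, add_comm]
        have h := mul_le_mul_of_nonneg_left (ih w (x + a k) hw) (Nat.cast_nonneg (w k + 1))
        rw [prod_factorial_add_single, hend]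
        simpa [mul_assoc] using h
    calc ((n + 1).factorial : ℝ) * F (x + ∑ k, z k • a k)
        = ∑ k, z k * (n.factorial * F (x + ∑ j, z j • a j)) := by
          rw [← Finset.sum_mul, ← Nat.cast_sum, hn, Nat.factorial_succ, Nat.cast_mul, mul_assoc]
      _ ≤ ∑ k, (∏ j, (z j).factorial : ℕ) * (Fintype.card κ : ℝ) ^ n *
            (stepAvg a ^ n) F (x + a k) := Finset.sum_le_sum fun k _ => hletter k
      _ = (∏ j, (z j).factorial : ℕ) * (Fintype.card κ : ℝ) ^ (n + 1) *
            (stepAvg a ^ (n + 1)) F x := by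
          rw [← Finset.mul_sum, stepAvg_pow_succ_apply]
          rw [pow_succ]
          field_simp

end Multinomial

section Factorial

theorem factorial_pow_mul_pow_le (N : ℕ) {m : ℕ} (hm : 1 ≤ m) :
    m.factorial ^ N * N ^ (N * m) ≤ (N * m) ^ N * (N * m).factorial := by
  induction m, hm using Nat.le_induction with
  | base => simpa using Nat.le_mul_of_pos_right _ N.factorial_pos
  | succ m _ ih =>
    calc (m + 1).factorial ^ N * N ^ (N * (m + 1))
        = (N * (m + 1)) ^ N * (m.factorial ^ N * N ^ (N * m)) := by
          rw [Nat.factorial_succ, mul_pow, mul_pow, mul_add_one N m, pow_add]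
          ring
      _ ≤ (N * (m + 1)) ^ N * ((N * m) ^ N * (N * m).factorial) := by gcongr
      _ ≤ (N * (m + 1)) ^ N * ((N * m).factorial * (N * m + 1) ^ N) := by
          rw [mul_comm ((N * m) ^ N)]
          gcongr
          exact Nat.le_succ _
      _ ≤ (N * (m + 1)) ^ N * (N * (m + 1)).factorial := by
          gcongr
          exact Nat.factorial_mul_pow_le_factorial

theorem factorial_add_le {m t : ℕ} (hm : 1 ≤ m) (ht : t ^ 2 ≤ m) :
    ((m + t).factorial : ℝ) ≤ m.factorial * m ^ t * Real.exp 1 := by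
  have hm0 : (0 : ℝ) < m := by exact_mod_cast hm
  have ht' : (t : ℝ) ^ 2 ≤ m := by exact_mod_cast ht
  have hpow : ((m + t : ℕ) : ℝ) ^ t ≤ m ^ t * Real.exp 1 :=
    calc ((m + t : ℕ) : ℝ) ^ t = m ^ t * (t / m + 1) ^ t := by
          rw [← mul_pow, mul_add, mul_div_cancel₀ _ hm0.ne', mul_one, Nat.cast_add, add_comm]
      _ ≤ m ^ t * Real.exp (t / m) ^ t := by
          gcongr
          exact Real.add_one_le_exp _
      _ ≤ m ^ t * Real.exp 1 := by
          rw [← Real.exp_nat_mul]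
          gcongr
          rw [← mul_div_assoc, div_le_one hm0, ← sq]
          exact ht'
  calc ((m + t).factorial : ℝ) ≤ m.factorial * ((m + t : ℕ) : ℝ) ^ t := by
        rw [← Nat.factorial_mul_ascFactorial]
        exact_mod_cast Nat.mul_le_mul_left _ (Nat.ascFactorial_le_pow_add m t)
    _ ≤ m.factorial * (m ^ t * Real.exp 1) := by gcongr
    _ = m.factorial * m ^ t * Real.exp 1 := (mul_assoc _ _ _).symm

/-- Up to a polynomial factor, a multinomial coefficient near the centre is as large as
possible. -/
theorem prod_factorial_mul_pow_le {κ : Type*} [Fintype κ] {m : ℕ} (hm : 1 ≤ m) {t : κ → ℕ}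
    (ht : ∀ k, t k ^ 2 ≤ m) :
    (∏ k, (m + t k).factorial : ℕ) * (Fintype.card κ : ℝ) ^ (∑ k, (m + t k)) ≤
      (Real.exp 1 * (Fintype.card κ * m)) ^ Fintype.card κ * (∑ k, (m + t k)).factorial := by
  set N := Fintype.card κ
  have hsum : ∑ k, (m + t k) = N * m + ∑ k, t k := by simp [Finset.sum_add_distrib, N]
  have hprod : ((∏ k, (m + t k).factorial : ℕ) : ℝ) ≤
      m.factorial ^ N * m ^ (∑ k, t k) * Real.exp 1 ^ N := by
    calc ((∏ k, (m + t k).factorial : ℕ) : ℝ)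
        ≤ ∏ k, (m.factorial * m ^ t k * Real.exp 1 : ℝ) := by
          rw [Nat.cast_prod]
          gcongr with k
          exact factorial_add_le hm (ht k)
      _ = m.factorial ^ N * m ^ (∑ k, t k) * Real.exp 1 ^ N := by
          simp [Finset.prod_mul_distrib, Finset.prod_pow_eq_pow_sum, N]
  have hcentre : (m.factorial : ℝ) ^ N * N ^ (N * m) ≤ (N * m) ^ N * (N * m).factorial := by
    exact_mod_cast factorial_pow_mul_pow_le N hm
  have htail : ((N * m).factorial : ℝ) * (N * m) ^ (∑ k, t k) ≤
      (N * m + ∑ k, t k).factorial := by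
    exact_mod_cast (Nat.mul_le_mul_left _ (Nat.pow_le_pow_left (Nat.le_succ (N * m)) _)).trans
      Nat.factorial_mul_pow_le_factorial
  rw [hsum]
  calc ((∏ k, (m + t k).factorial : ℕ) : ℝ) * (N : ℝ) ^ (N * m + ∑ k, t k)
      ≤ m.factorial ^ N * m ^ (∑ k, t k) * Real.exp 1 ^ N * (N : ℝ) ^ (N * m + ∑ k, t k) := by
        gcongr
    _ = Real.exp 1 ^ N * ((m.factorial : ℝ) ^ N * N ^ (N * m)) * (N * m) ^ (∑ k, t k) := by
        rw [pow_add]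
        ring
    _ ≤ Real.exp 1 ^ N * ((N * m) ^ N * (N * m).factorial) * (N * m) ^ (∑ k, t k) := by gcongr
    _ = (Real.exp 1 * (N * m)) ^ N * ((N * m).factorial * (N * m) ^ (∑ k, t k)) := by ring
    _ ≤ (Real.exp 1 * (N * m)) ^ N * (N * m + ∑ k, t k).factorial := by gcongr

end Factorial

section Recurrence

variable {κ M : Type*} [Fintype κ] [AddCommMonoid M]

/-- A balanced walk visits the point `x + ∑ k, t k • a k` after a time of order `m` with
probability at least a negative power of `m`. -/
theorem le_mul_stepAvg_pow {a : κ → M} (ha : ∑ k, a k = 0) {F : M → ℝ} (hF : 0 ≤ F) {m : ℕ}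
    (hm : 1 ≤ m) {t : κ → ℕ} (ht : ∀ k, t k ^ 2 ≤ m) (x : M) :
    F (x + ∑ k, t k • a k) ≤ (Real.exp 1 * (Fintype.card κ * m)) ^ Fintype.card κ *
      (stepAvg a ^ (∑ k, (m + t k))) F x := by
  set n := ∑ k, (m + t k)
  have hend : ∑ k, (m + t k) • a k = ∑ k, t k • a k := by
    simp [add_smul, Finset.sum_add_distrib, ← Finset.smul_sum, ha]
  have hlower := factorial_mul_le_stepAvg_pow a hF (fun k => m + t k) x
  rw [hend] at hlower
  have hupper := mul_le_mul_of_nonneg_right (prod_factorial_mul_pow_le hm ht)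
    (stepAvg_pow_nonneg a n hF x)
  have hfact : (0 : ℝ) < n.factorial := by exact_mod_cast n.factorial_pos
  refine le_of_mul_le_mul_left ((hlower.trans hupper).trans_eq ?_) hfact
  ring

end Recurrence

section Length

variable {G : Type*} [AddCommGroup G] {S : Multiset G}

/-- The word length of `x` with respect to `S`, i.e. its distance to the identity. -/
noncomputable def len (S : Multiset G) (x : G) : ℕ :=
  wordDist S 0 x

theorem exists_path_iff {x y : G} {k : ℕ} :
    (∃ c : ℕ → G, c 0 = x ∧ c k = y ∧ ∀ i < k, Adj S (c i) (c (i + 1))) ↔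
      ∃ l : Multiset G, l.card = k ∧ (∀ s ∈ l, s ∈ S) ∧ l.sum = y - x := by
  constructor
  · rintro ⟨c, rfl, rfl, hc⟩
    refine ⟨(Multiset.range k).map fun i => c (i + 1) - c i, by simp, ?_,
      Finset.sum_range_sub c k⟩
    simpa [Adj] using hc
  · rintro ⟨l, rfl, hl, hsum⟩
    induction l using Quotient.inductionOn with | h l => ?_
    refine ⟨fun i => x + (l.take i).sum, by simp, by simp_all, fun i hi => ?_⟩
    have hi' : i < l.length := hi
    simpa [Adj, List.sum_take_succ l i hi'] using hl _ (List.getElem_mem hi')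

theorem wordDist_eq_len_sub (S : Multiset G) (x y : G) : wordDist S x y = len S (y - x) := by
  simp only [len, wordDist, exists_path_iff, sub_zero]

theorem len_sum_le {l : Multiset G} (hl : ∀ s ∈ l, s ∈ S) : len S l.sum ≤ l.card :=
  Nat.sInf_le (exists_path_iff.2 ⟨l, rfl, hl, (sub_zero _).symm⟩)

theorem len_zero (S : Multiset G) : len S 0 = 0 := by
  simpa using len_sum_le (S := S) (l := 0) (by simp)

namespace IsSymmGen

variable (hS : IsSymmGen S)

include hS

theorem neg_mem {s : G} (hs : s ∈ S) : -s ∈ S := by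
  rw [← hS.symm]
  exact Multiset.mem_map_of_mem _ hs

theorem exists_multiset_card_eq_len (x : G) :
    ∃ l : Multiset G, l.card = len S x ∧ (∀ s ∈ l, s ∈ S) ∧ l.sum = x := by
  have hneg : -{s | s ∈ S} = {s | s ∈ S} := by
    ext s
    exact ⟨fun h => by simpa using hS.neg_mem h, hS.neg_mem⟩
  have hx : x ∈ AddSubmonoid.closure {s | s ∈ S} := by
    have h := AddSubgroup.closure_toAddSubmonoid {s | s ∈ S}
    rw [hS.gen, hneg, Set.union_self] at h
    exact h ▸ AddSubmonoid.mem_top x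
  obtain ⟨l, hl, rfl⟩ := AddSubmonoid.exists_multiset_of_mem_closure hx
  have hpath : ∃ c : ℕ → G, c 0 = 0 ∧ c (len S l.sum) = l.sum ∧
      ∀ i < len S l.sum, Adj S (c i) (c (i + 1)) :=
    Nat.sInf_mem (s := {k | ∃ c : ℕ → G, c 0 = 0 ∧ c k = l.sum ∧ ∀ i < k, Adj S (c i) (c (i + 1))})
      ⟨l.card, exists_path_iff.2 ⟨l, rfl, hl, (sub_zero _).symm⟩⟩
  obtain ⟨l', hcard, hl', hsum⟩ := exists_path_iff.1 hpath
  exact ⟨l', hcard, hl', by simpa using hsum⟩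

theorem len_add_le (x y : G) : len S (x + y) ≤ len S x + len S y := by
  obtain ⟨l, hl, hlS, rfl⟩ := hS.exists_multiset_card_eq_len x
  obtain ⟨l', hl', hlS', rfl⟩ := hS.exists_multiset_card_eq_len y
  rw [← hl, ← hl', ← Multiset.sum_add, ← Multiset.card_add]
  exact len_sum_le fun s hs => (Multiset.mem_add.1 hs).elim (hlS s) (hlS' s)

theorem len_neg_le (x : G) : len S (-x) ≤ len S x := by
  obtain ⟨l, hl, hlS, rfl⟩ := hS.exists_multiset_card_eq_len x
  rw [← hl, ← Multiset.sum_map_neg', ← Multiset.card_map Neg.neg l]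
  refine len_sum_le fun s hs => ?_
  obtain ⟨r, hr, rfl⟩ := Multiset.mem_map.1 hs
  exact hS.neg_mem (hlS r hr)

theorem len_zsmul_le (c : ℤ) (x : G) : len S (c • x) ≤ c.natAbs * len S x := by
  have hnat (n : ℕ) (y : G) : len S (n • y) ≤ n * len S y := by
    simpa using Finset.le_sum_of_subadditive (len S) (len_zero S).le hS.len_add_le
      (Finset.range n) fun _ => y
  obtain ⟨n, rfl | rfl⟩ := c.eq_nat_or_neg
  · simpa using hnat n x
  · simpa using (hS.len_neg_le _).trans (hnat n x)

theorem len_add_one_le_mul (x y : G) :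
    (len S (x + y) : ℝ) + 1 ≤ (len S x + 1) * (len S y + 1) := by
  have h : (len S (x + y) : ℝ) ≤ len S x + len S y := by exact_mod_cast hS.len_add_le x y
  nlinarith [(len S x).cast_nonneg (α := ℝ), (len S y).cast_nonneg (α := ℝ)]

end IsSymmGen

end Length

section LazyWalk

variable {G : Type*} [AddCommGroup G]

/-- The steps of the walk attached to `S`: the zero step once, and every element of `S` twice. The
doubling makes the steps sum to `0` even in the presence of 2-torsion. -/
noncomputable def lazyStep (S : Multiset G) (k : Fin (0 ::ₘ (S + S)).toList.length) : G :=
  (0 ::ₘ (S + S)).toList[k]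

variable {S : Multiset G}

theorem sum_lazyStep {A : Type*} [AddCommMonoid A] (F : G → A) :
    ∑ k, F (lazyStep S k) = F 0 + 2 • (S.map F).sum := by
  have h := Fin.sum_univ_fun_getElem (0 ::ₘ (S + S)).toList F
  rw [← Multiset.sum_coe, ← Multiset.map_coe, Multiset.coe_toList] at h
  rw [two_nsmul, ← Multiset.sum_add, ← Multiset.map_add, ← Multiset.sum_cons,
    ← Multiset.map_cons]
  exact h

theorem exists_lazyStep_eq {s : G} (hs : s ∈ 0 ::ₘ (S + S)) : ∃ k, lazyStep S k = s := by
  obtain ⟨i, hi, rfl⟩ := List.mem_iff_getElem.1 (Multiset.mem_toList.2 hs)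
  exact ⟨⟨i, hi⟩, rfl⟩

theorem exists_lazyStep_eq_zero (S : Multiset G) : ∃ o, lazyStep S o = 0 :=
  exists_lazyStep_eq (Multiset.mem_cons_self _ _)

theorem exists_lazyStep_eq_of_mem {s : G} (hs : s ∈ S) : ∃ k, lazyStep S k = s :=
  exists_lazyStep_eq (Multiset.mem_cons_of_mem (Multiset.mem_add.2 (Or.inl hs)))

theorem len_lazyStep_le (k) : len S (lazyStep S k) ≤ 1 := by
  have hmem : lazyStep S k ∈ 0 ::ₘ (S + S) := Multiset.mem_toList.1 (List.getElem_mem _)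
  rcases Multiset.mem_cons.1 hmem with h | h
  · simp [h, len_zero]
  · simpa using len_sum_le (S := S) (l := {lazyStep S k}) (by simpa using h)

theorem IsHarmonic.stepAvg_lazyStep {u : G → ℝ} (hu : IsHarmonic S u) :
    stepAvg (lazyStep S) u = u := by
  funext x
  have hcard : (Fintype.card (Fin (0 ::ₘ (S + S)).toList.length) : ℝ) ≠ 0 := by
    simp [-Nat.cast_add]
  have h := sum_lazyStep (S := S) fun s => u (x + s) - u x
  have hL : (S.map fun s => u (x + s) - u x).sum = 0 := hu x
  rw [hL, Finset.sum_sub_distrib, add_zero, sub_self, smul_zero, zero_add, sub_eq_zero] at h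
  rw [stepAvg_apply, h, Finset.sum_const, Finset.card_univ, nsmul_eq_mul,
    inv_mul_cancel_left₀ hcard]

theorem exists_count_of_multiset {l : Multiset G} (hl : ∀ s ∈ l, s ∈ S) :
    ∃ t : _ → ℕ, ∑ k, t k = l.card ∧ ∑ k, t k • lazyStep S k = l.sum := by
  induction l using Multiset.induction with
  | empty => exact ⟨0, by simp⟩
  | cons s l ih =>
    obtain ⟨t, ht, hsum⟩ := ih fun s hs => hl s (Multiset.mem_cons_of_mem hs)
    obtain ⟨k, rfl⟩ := exists_lazyStep_eq_of_mem (hl s (Multiset.mem_cons_self s l))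
    refine ⟨t + Pi.single k 1, ?_, ?_⟩
    · simp [Finset.sum_add_distrib, ht]
    · simp [add_smul, Finset.sum_add_distrib, Pi.single_apply, hsum, add_comm]

namespace IsSymmGen

variable (hS : IsSymmGen S)

include hS

theorem sum_lazyStep_eq_zero : ∑ k, lazyStep S k = 0 := by
  have hneg : S.sum = -S.sum := by
    conv_lhs => rw [← hS.symm, Multiset.sum_map_neg']
  have h := sum_lazyStep (S := S) id
  simp only [id, zero_add, Multiset.map_id', two_nsmul] at h
  rw [h, eq_neg_iff_add_eq_zero.1 hneg]

theorem len_add_linearCombination_le (o) (x : G) (z) :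
    (len S (x + Fintype.linearCombination ℕ (lazyStep S) z) : ℝ) + 1 ≤
      (len S x + 1) * (1 + spread o z) := by
  have hbalance : Fintype.linearCombination ℕ (lazyStep S) z =
      ∑ k, ((z k : ℤ) - z o) • lazyStep S k := by
    simp [Fintype.linearCombination_apply, sub_smul, ← Finset.smul_sum, hS.sum_lazyStep_eq_zero]
  have hlen : (len S (Fintype.linearCombination ℕ (lazyStep S) z) : ℝ) ≤ spread o z := by
    have h : len S (∑ k, ((z k : ℤ) - z o) • lazyStep S k) ≤ ∑ k, ((z k : ℤ) - z o).natAbs := by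
      refine (Finset.le_sum_of_subadditive _ (len_zero S).le hS.len_add_le _ _).trans ?_
      gcongr with k
      exact (hS.len_zsmul_le _ _).trans (mul_le_of_le_one_right (Nat.zero_le _) (len_lazyStep_le k))
    rw [hbalance]
    refine (Nat.cast_le.2 h).trans_eq ?_
    simp [spread, countDiff_apply, Nat.cast_natAbs]
  refine (hS.len_add_one_le_mul x _).trans ?_
  rw [add_comm 1]
  gcongr

end IsSymmGen

end LazyWalk

section MeanGrowth

variable {G : Type*} [AddCommGroup G] {S : Multiset G}

/-- `u` grows at most like `n ^ a` in mean along the walk attached to `S`, from every starting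
point. -/
def HasMeanGrowth (S : Multiset G) (u : G → ℝ) (a : ℝ) : Prop :=
  ∀ x, (fun n : ℕ => (stepAvg (lazyStep S) ^ n) |u| x) =O[atTop] fun n => (n : ℝ) ^ a

theorem IsSymmGen.stepAvg_pow_len_rpow_le (hS : IsSymmGen S) {p : ℝ} (hp : 0 ≤ p) :
    ∃ C, 0 ≤ C ∧ ∀ n : ℕ, 1 ≤ n → ∀ x,
      (stepAvg (lazyStep S) ^ n) (fun y => ((len S y : ℝ) + 1) ^ p) x ≤
        C * (n : ℝ) ^ (p / 2) * ((len S x : ℝ) + 1) ^ p := by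
  obtain ⟨o, -⟩ := exists_lazyStep_eq_zero S
  obtain ⟨C, hC, hmoment⟩ := countMean_spread_rpow_le o hp
  refine ⟨C, hC, fun n hn x => ?_⟩
  have hpoint : (fun z => ((len S (x + Fintype.linearCombination ℕ (lazyStep S) z) : ℝ) + 1) ^ p) ≤
      ((len S x : ℝ) + 1) ^ p • fun z => (1 + spread o z) ^ p := by
    intro z
    have hspread := spread_nonneg o z
    simp only [Pi.smul_apply, smul_eq_mul]
    rw [← Real.mul_rpow (by positivity) (by positivity)]
    gcongr
    exact hS.len_add_linearCombination_le o x z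
  rw [stepAvg_pow_apply_eq_countMean]
  refine (countMean_mono n hpoint).trans ?_
  rw [map_smul, smul_eq_mul, mul_comm]
  gcongr
  exact hmoment n hn

theorem IsHarmonic.hasMeanGrowth_of_neg_le {u : G → ℝ} (hu : IsHarmonic S u) (hS : IsSymmGen S)
    {C d : ℝ} (hC : 0 ≤ C) (hd : 0 ≤ d) (h : ∀ x, -(C * ((len S x : ℝ) + 1) ^ d) ≤ u x) :
    HasMeanGrowth S u (d / 2) := by
  intro x
  obtain ⟨A, -, hlen⟩ := hS.stepAvg_pow_len_rpow_le hd
  have habs : |u| ≤ u + (2 * C) • fun y => ((len S y : ℝ) + 1) ^ d := by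
    intro y
    have hy := h y
    have hpos : 0 ≤ C * ((len S y : ℝ) + 1) ^ d := by positivity
    exact abs_le'.2 ⟨by simp; linarith, by simp; linarith⟩
  refine IsBigO.of_bound (|u x| + 2 * C * (A * ((len S x : ℝ) + 1) ^ d)) ?_
  filter_upwards [eventually_ge_atTop 1] with n hn
  have hn1 : 1 ≤ (n : ℝ) ^ (d / 2) := Real.one_le_rpow (by exact_mod_cast hn) (by positivity)
  have hnonneg := stepAvg_pow_nonneg (lazyStep S) n (abs_nonneg u) x
  rw [Real.norm_of_nonneg hnonneg, Real.norm_of_nonneg (by positivity)]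
  calc (stepAvg (lazyStep S) ^ n) |u| x
      ≤ u x + 2 * C * (stepAvg (lazyStep S) ^ n) (fun y => ((len S y : ℝ) + 1) ^ d) x := by
        simpa [map_add, map_smul, stepAvg_pow_eq_self hu.stepAvg_lazyStep] using
          stepAvg_pow_mono (lazyStep S) n habs x
    _ ≤ |u x| * (n : ℝ) ^ (d / 2) +
          2 * C * (A * (n : ℝ) ^ (d / 2) * ((len S x : ℝ) + 1) ^ d) := by
        gcongr
        · exact (le_abs_self _).trans (le_mul_of_one_le_right (abs_nonneg _) hn1)
        · exact hlen n hn x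
    _ = (|u x| + 2 * C * (A * ((len S x : ℝ) + 1) ^ d)) * (n : ℝ) ^ (d / 2) := by ring

theorem IsSymmGen.exists_le_stepAvg_pow (hS : IsSymmGen S) :
    ∃ (A : ℝ) (N : ℕ), 0 ≤ A ∧ ∀ F : G → ℝ, 0 ≤ F → ∀ y, ∃ n : ℕ, 1 ≤ n ∧
      (n : ℝ) ≤ N * ((len S y : ℝ) + 1) ^ 2 ∧
      F y ≤ A * ((len S y : ℝ) + 1) ^ N * (stepAvg (lazyStep S) ^ n) F 0 := by
  set N := Fintype.card (Fin (0 ::ₘ (S + S)).toList.length) with hN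
  have hN1 : 1 ≤ N := by simp [N]
  refine ⟨(Real.exp 1 * N) ^ N, 2 * N, by positivity, fun F hF y => ?_⟩
  obtain ⟨l, hl, hlS, hsum⟩ := hS.exists_multiset_card_eq_len y
  obtain ⟨t, ht, hty⟩ := exists_count_of_multiset hlS
  set L := len S y
  have hm : 1 ≤ (L + 1) ^ 2 := Nat.one_le_pow _ _ L.succ_pos
  have htm (k) : t k ^ 2 ≤ (L + 1) ^ 2 := by
    have htk : t k ≤ L := (Finset.single_le_sum (fun _ _ => Nat.zero_le _)
      (Finset.mem_univ k)).trans_eq (ht.trans hl)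
    exact Nat.pow_le_pow_left (htk.trans L.le_succ) 2
  have htime : ∑ k, ((L + 1) ^ 2 + t k) = N * (L + 1) ^ 2 + L := by
    simp [Finset.sum_add_distrib, ht, hl, N]
  have hvisit := le_mul_stepAvg_pow hS.sum_lazyStep_eq_zero hF hm htm 0
  rw [hty, hsum, zero_add, ← hN, htime] at hvisit
  refine ⟨N * (L + 1) ^ 2 + L, by nlinarith, ?_, hvisit.trans_eq ?_⟩
  · have hL : N * (L + 1) ^ 2 + L ≤ 2 * N * (L + 1) ^ 2 := by nlinarith
    exact_mod_cast hL
  · rw [pow_mul, Nat.cast_pow, Nat.cast_succ, ← mul_assoc, mul_pow]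

theorem HasMeanGrowth.exists_abs_le_pow {u : G → ℝ} {a : ℝ} (h : HasMeanGrowth S u a)
    (hS : IsSymmGen S) : ∃ (K : ℝ) (D : ℕ), ∀ x, |u x| ≤ K * ((len S x : ℝ) + 1) ^ D := by
  set E := ⌈a⌉₊
  obtain ⟨C, hC, hmean⟩ := bound_of_isBigO_nat_atTop (h 0)
  obtain ⟨A, N, hA, hvisit⟩ := hS.exists_le_stepAvg_pow
  refine ⟨A * (C * (N : ℝ) ^ E), N + 2 * E, fun y => ?_⟩
  obtain ⟨n, hn, hnle, hy⟩ := hvisit |u| (abs_nonneg u) y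
  have hn1 : (1 : ℝ) ≤ n := by exact_mod_cast hn
  have hPn : (stepAvg (lazyStep S) ^ n) |u| 0 ≤ C * (N * ((len S y : ℝ) + 1) ^ 2) ^ E :=
    calc (stepAvg (lazyStep S) ^ n) |u| 0 ≤ C * (n : ℝ) ^ a := by
          have hna : 0 < (n : ℝ) ^ a := by positivity
          have hbound := (le_abs_self _).trans (hmean hna.ne')
          rwa [Real.norm_of_nonneg hna.le] at hbound
      _ ≤ C * (n : ℝ) ^ E := by
          rw [← Real.rpow_natCast]
          gcongr
          exact Nat.le_ceil a
      _ ≤ C * (N * ((len S y : ℝ) + 1) ^ 2) ^ E := by gcongr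
  calc |u y| ≤ A * ((len S y : ℝ) + 1) ^ N * (C * (N * ((len S y : ℝ) + 1) ^ 2) ^ E) :=
        hy.trans (mul_le_mul_of_nonneg_left hPn (by positivity))
    _ = A * (C * (N : ℝ) ^ E) * ((len S y : ℝ) + 1) ^ (N + 2 * E) := by
        rw [mul_pow, ← pow_mul, pow_add]
        ring

theorem le_add_rpow_mul_rpow {t B q : ℝ} (ht : 0 ≤ t) (hB : 0 < B) (hq : 0 ≤ q) :
    t ≤ B + t ^ (q + 1) * B ^ (-q) := by
  rcases le_total t B with h | h
  · exact h.trans (le_add_of_nonneg_right (by positivity))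
  · calc t = t ^ (q + 1) * t ^ (-q) := by
          rw [← Real.rpow_add (hB.trans_le h), add_neg_cancel_comm, Real.rpow_one]
      _ ≤ t ^ (q + 1) * B ^ (-q) := by
          gcongr ?_ * ?_
          exact Real.rpow_le_rpow_of_nonpos hB h (by linarith)
      _ ≤ B + t ^ (q + 1) * B ^ (-q) := le_add_of_nonneg_left hB.le

theorem mul_le_mul_add_rpow_mul {s t v V B p q : ℝ} (hs : 0 < s) (ht : 0 ≤ t) (hts : t ≤ s)
    (hv : 0 ≤ v) (hvs : v ≤ V * s ^ p) (hB : 0 < B) (hq : 0 ≤ q) :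
    t * v ≤ B * v + B ^ (-q) * V * s ^ (q + 1 + p) :=
  calc t * v ≤ (B + t ^ (q + 1) * B ^ (-q)) * v := by
        gcongr
        exact le_add_rpow_mul_rpow ht hB hq
    _ ≤ B * v + s ^ (q + 1) * B ^ (-q) * (V * s ^ p) := by
        rw [add_mul]
        gcongr
    _ = B * v + B ^ (-q) * V * s ^ (q + 1 + p) := by
        rw [Real.rpow_add hs (q + 1) p]
        ring

/-- In the integration by parts formula the letter counts deviate by more than `B` only on an event
whose contribution is controlled by a high moment. -/
theorem IsHarmonic.mul_abs_fwdDiff_le {u : G → ℝ} (hu : IsHarmonic S u) (hS : IsSymmGen S)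
    {K p q : ℝ} (hp : 0 ≤ p) (hq : 0 ≤ q) (hK : ∀ x, |u x| ≤ K * ((len S x : ℝ) + 1) ^ p) (k) :
    ∃ A C, 0 ≤ C ∧ ∀ n : ℕ, 1 ≤ n → ∀ B > 0, ∀ x, n * |fwdDiff (lazyStep S k) u x| ≤
      A * B * (stepAvg (lazyStep S) ^ n) |u| x +
        C * B ^ (-q) * (n : ℝ) ^ ((q + 1 + p) / 2) * ((len S x : ℝ) + 1) ^ p := by
  obtain ⟨o, ho⟩ := exists_lazyStep_eq_zero S
  obtain ⟨C, hC, hmoment⟩ := countMean_spread_rpow_le o (by positivity : 0 ≤ q + 1 + p)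
  set N := Fintype.card (Fin (0 ::ₘ (S + S)).toList.length)
  have hK0 : 0 ≤ K := by simpa [len_zero] using (abs_nonneg _).trans (hK 0)
  refine ⟨N, N * (K * C), by positivity, fun n hn B hB x => ?_⟩
  set v : (_ → ℕ) → ℝ := fun z => u (x + Fintype.linearCombination ℕ (lazyStep S) z)
  have hv (z) : |v z| ≤ K * ((len S x : ℝ) + 1) ^ p * (1 + spread o z) ^ p := by
    have hspread := spread_nonneg o z
    refine (hK _).trans ?_
    rw [mul_assoc, ← Real.mul_rpow (by positivity) (by positivity)]
    gcongr
    exact hS.len_add_linearCombination_le o x z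
  have hpoint : |⇑(countDiff k o) * v| ≤ B • |v| +
      (B ^ (-q) * (K * ((len S x : ℝ) + 1) ^ p)) • fun z => (1 + spread o z) ^ (q + 1 + p) := by
    intro z
    have hspread := spread_nonneg o z
    rw [Pi.abs_apply, Pi.mul_apply, abs_mul]
    exact mul_le_mul_add_rpow_mul (by positivity) (abs_nonneg _)
      ((abs_countDiff_le_spread o k z).trans (le_add_of_nonneg_left zero_le_one))
      (abs_nonneg _) (hv z) hB hq
  have hparts := card_mul_countMean_countDiff_mul_comp hu.stepAvg_lazyStep k o n x
  calc n * |fwdDiff (lazyStep S k) u x| = |N * countMean n (⇑(countDiff k o) * v)| := by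
        rw [hparts, ho, add_zero, abs_mul, Nat.abs_cast, fwdDiff]
    _ ≤ N * countMean n |⇑(countDiff k o) * v| := by
        rw [abs_mul, Nat.abs_cast]
        gcongr
        exact abs_countMean_le n _
    _ ≤ N * (B * countMean n |v| + B ^ (-q) * (K * ((len S x : ℝ) + 1) ^ p) *
          (C * (n : ℝ) ^ ((q + 1 + p) / 2))) := by
        gcongr
        refine (countMean_mono n hpoint).trans ?_
        rw [map_add, map_smul, map_smul, smul_eq_mul, smul_eq_mul]
        gcongr
        exact hmoment n hn
    _ = N * B * (stepAvg (lazyStep S) ^ n) |u| x + N * (K * C) * B ^ (-q) *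
          (n : ℝ) ^ ((q + 1 + p) / 2) * ((len S x : ℝ) + 1) ^ p := by
        rw [stepAvg_pow_apply_eq_countMean]
        simp only [v, Pi.abs_def]
        ring

theorem IsHarmonic.stepAvg_pow_abs_fwdDiff_le {u : G → ℝ} (hu : IsHarmonic S u)
    (hS : IsSymmGen S) {K p ε : ℝ} (hp : 0 ≤ p) (hK : ∀ x, |u x| ≤ K * ((len S x : ℝ) + 1) ^ p)
    (hε : 0 < ε) (b : ℝ) (k) :
    ∃ A, ∀ x, ∃ C, ∀ n : ℕ, 1 ≤ n →
      (stepAvg (lazyStep S) ^ n) |fwdDiff (lazyStep S k) u| x ≤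
        A * ((n : ℝ) ^ (ε - 1 / 2) * (stepAvg (lazyStep S) ^ (n + n)) |u| x) +
          C * (n : ℝ) ^ b := by
  obtain ⟨q, hq⟩ := exists_nat_gt ((p - 1 / 2 - b) / ε)
  rw [div_lt_iff₀ hε] at hq
  obtain ⟨A, C, hC, hgrad⟩ := hu.mul_abs_fwdDiff_le hS hp q.cast_nonneg hK k
  obtain ⟨W, hW, hlen⟩ := hS.stepAvg_pow_len_rpow_le hp
  refine ⟨A, fun x => ⟨C * W * ((len S x : ℝ) + 1) ^ p, fun n hn => ?_⟩⟩
  have hn1 : (1 : ℝ) ≤ n := by exact_mod_cast hn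
  have hn0 : (0 : ℝ) < n := by positivity
  set B := (n : ℝ) ^ (1 / 2 + ε) with hB
  have hpoint : (n : ℝ) • |fwdDiff (lazyStep S k) u| ≤ (A * B) • (stepAvg (lazyStep S) ^ n) |u| +
      (C * B ^ (-(q : ℝ)) * (n : ℝ) ^ ((q + 1 + p) / 2)) • fun y => ((len S y : ℝ) + 1) ^ p :=
    fun y => hgrad n hn B (by positivity) y
  have hmean := stepAvg_pow_mono (lazyStep S) n hpoint x
  simp only [map_add, map_smul, Pi.add_apply, Pi.smul_apply, smul_eq_mul,
    ← Module.End.mul_apply, ← pow_add] at hmean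
  have hmul (c : ℝ) : n * (n : ℝ) ^ c = (n : ℝ) ^ (1 + c) := by
    rw [Real.rpow_add hn0, Real.rpow_one]
  have hexp : B ^ (-(q : ℝ)) * (n : ℝ) ^ ((q + 1 + p) / 2) * (n : ℝ) ^ (p / 2) ≤
      n * (n : ℝ) ^ b := by
    rw [hB, ← Real.rpow_mul hn0.le, ← Real.rpow_add hn0, ← Real.rpow_add hn0, hmul]
    exact Real.rpow_le_rpow_of_exponent_le hn1 (by linarith)
  have hBn : B = n * (n : ℝ) ^ (ε - 1 / 2) := by
    rw [hB, hmul]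
    ring_nf
  refine le_of_mul_le_mul_left (hmean.trans ?_) hn0
  calc _ ≤ A * B * (stepAvg (lazyStep S) ^ (n + n)) |u| x + C * B ^ (-(q : ℝ)) *
        (n : ℝ) ^ ((q + 1 + p) / 2) * (W * (n : ℝ) ^ (p / 2) * ((len S x : ℝ) + 1) ^ p) := by
        gcongr
        exact hlen n hn x
    _ = A * B * (stepAvg (lazyStep S) ^ (n + n)) |u| x + C * W * ((len S x : ℝ) + 1) ^ p *
        (B ^ (-(q : ℝ)) * (n : ℝ) ^ ((q + 1 + p) / 2) * (n : ℝ) ^ (p / 2)) := by ring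
    _ ≤ A * B * (stepAvg (lazyStep S) ^ (n + n)) |u| x + C * W * ((len S x : ℝ) + 1) ^ p *
        (n * (n : ℝ) ^ b) := by gcongr
    _ = _ := by
        rw [hBn]
        ring

theorem HasMeanGrowth.fwdDiff_lazyStep {u : G → ℝ} {a b : ℝ} (h : HasMeanGrowth S u a)
    (hu : IsHarmonic S u) (hS : IsSymmGen S) (hab : a - 1 / 2 < b) (k) :
    HasMeanGrowth S (fwdDiff (lazyStep S k) u) b := by
  intro x
  obtain ⟨K, D, hK⟩ := h.exists_abs_le_pow hS
  simp only [← Real.rpow_natCast] at hK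
  obtain ⟨A, hmain⟩ := hu.stepAvg_pow_abs_fwdDiff_le hS D.cast_nonneg hK (sub_pos.2 hab) b k
  obtain ⟨C, hmain⟩ := hmain x
  have hdouble : (fun n : ℕ => (stepAvg (lazyStep S) ^ (n + n)) |u| x) =O[atTop]
      fun n => (n : ℝ) ^ a := by
    refine ((h x).comp_tendsto
      (tendsto_atTop_mono (fun n => Nat.le_add_left n n) tendsto_id)).trans ?_
    refine (isBigO_refl (fun n : ℕ => (n : ℝ) ^ a) atTop).const_mul_left (2 ^ a) |>.congr_left ?_
    intro n
    simp only [Function.comp_apply, ← two_mul, Nat.cast_mul, Nat.cast_ofNat]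
    exact (Real.mul_rpow zero_le_two n.cast_nonneg).symm
  have hleading : (fun n : ℕ => A * ((n : ℝ) ^ (b - (a - 1 / 2) - 1 / 2) *
      (stepAvg (lazyStep S) ^ (n + n)) |u| x)) =O[atTop] fun n => (n : ℝ) ^ b := by
    refine (((isBigO_refl _ _).mul hdouble).const_mul_left A).congr' EventuallyEq.rfl ?_
    filter_upwards [eventually_gt_atTop 0] with n hn
    rw [← Real.rpow_add (by exact_mod_cast hn)]
    ring_nf
  refine IsBigO.trans (IsBigO.of_bound' ?_) (hleading.add ((isBigO_refl _ _).const_mul_left C))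
  filter_upwards [eventually_ge_atTop 1] with n hn
  rw [Real.norm_of_nonneg (stepAvg_pow_nonneg _ _ (abs_nonneg _) _)]
  exact (hmain n hn).trans (le_abs_self _)

end MeanGrowth

section Polynomial

variable {G : Type*} [AddCommGroup G]

/-- The polynomial maps `G → ℝ` of degree less than `j`, in the sense that all their `j`-fold
differences vanish. -/
noncomputable def degreeLT (G : Type*) [AddCommGroup G] : ℕ → Submodule ℤ (G → ℝ)
  | 0 => ⊥
  | j + 1 => ⨅ g, (degreeLT G j).comap (fwdDiff_aux.fwdDiffₗ G ℝ g)

theorem mem_degreeLT_succ {j : ℕ} {u : G → ℝ} :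
    u ∈ degreeLT G (j + 1) ↔ ∀ g, fwdDiff g u ∈ degreeLT G j := by
  simp only [degreeLT, Submodule.mem_iInf, Submodule.mem_comap]
  rfl

theorem degreeLT_comp_add_right {j : ℕ} {u : G → ℝ} (hu : u ∈ degreeLT G j) (g : G) :
    (fun x => u (x + g)) ∈ degreeLT G j := by
  induction j generalizing u with
  | zero =>
    obtain rfl : u = 0 := hu
    exact zero_mem (degreeLT G 0)
  | succ j ih =>
    refine mem_degreeLT_succ.2 fun h => ?_
    have hcomm : fwdDiff h (fun x => u (x + g)) = fun x => fwdDiff h u (x + g) := by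
      funext x
      simp only [fwdDiff, add_right_comm]
    exact hcomm ▸ ih (mem_degreeLT_succ.1 hu h)

theorem mem_degreeLT_succ_of_closure {T : Set G} (hT : AddSubgroup.closure T = ⊤) {j : ℕ}
    {u : G → ℝ} (h : ∀ g ∈ T, fwdDiff g u ∈ degreeLT G j) : u ∈ degreeLT G (j + 1) := by
  refine mem_degreeLT_succ.2 fun g => ?_
  have hg : g ∈ AddSubgroup.closure T := hT ▸ AddSubgroup.mem_top g
  induction hg using AddSubgroup.closure_induction with
  | mem g hg => exact h g hg
  | zero =>
    convert zero_mem (degreeLT G j) using 1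
    funext x
    simp [fwdDiff]
  | add g g' _ _ hg hg' =>
    convert add_mem (degreeLT_comp_add_right hg g') hg' using 1
    funext x
    simp [fwdDiff, add_assoc, add_comm g g']
  | neg g _ hg =>
    convert neg_mem (degreeLT_comp_add_right hg (-g)) using 1
    funext x
    simp [fwdDiff]

theorem add_eq_of_mem_degreeLT {j : ℕ} {u : G → ℝ} (hu : u ∈ degreeLT G j) {t : G}
    (ht : IsOfFinAddOrder t) (x : G) : u (x + t) = u x := by
  induction j generalizing u x with
  | zero =>
    obtain rfl : u = 0 := hu
    rfl
  | succ j ih =>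
    -- By induction `u` is affine along the orbit of `t`, and this orbit is periodic.
    have hstep (y : G) : fwdDiff t u (y + t) = fwdDiff t u y := ih (mem_degreeLT_succ.1 hu t) y
    have haffine (n : ℕ) : u (x + n • t) = u x + n * fwdDiff t u x ∧
        fwdDiff t u (x + n • t) = fwdDiff t u x := by
      induction n with
      | zero => simp
      | succ n ihn =>
        rw [succ_nsmul, ← add_assoc, hstep, ihn.2]
        refine ⟨?_, rfl⟩
        have h : u (x + n • t + t) - u (x + n • t) = fwdDiff t u x := ihn.2
        push_cast
        linarith [ihn.1]
    obtain ⟨n, hn, hnt⟩ := isOfFinAddOrder_iff_nsmul_eq_zero.1 ht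
    have h := (haffine n).1
    rw [hnt, add_zero, left_eq_add, mul_eq_zero, Nat.cast_eq_zero] at h
    exact sub_eq_zero.1 (h.resolve_left hn.ne')

variable {S : Multiset G}

theorem IsSymmGen.abs_le_pow_succ_of_abs_fwdDiff_le (hS : IsSymmGen S) {j : ℕ} {u : G → ℝ}
    {M : ℝ} (hM : 0 ≤ M) (h : ∀ s ∈ S, ∀ x, |fwdDiff s u x| ≤ M * ((len S x : ℝ) + 1) ^ j) (x : G) :
    |u x| ≤ (|u 0| + M) * ((len S x : ℝ) + 1) ^ (j + 1) := by
  have hword : ∀ l : Multiset G, (∀ s ∈ l, s ∈ S) →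
      |u l.sum| ≤ (|u 0| + M) * ((l.card : ℝ) + 1) ^ (j + 1) := by
    intro l hl
    induction l using Multiset.induction with
    | empty => simpa using hM
    | cons s l ih =>
      have hlS : ∀ s ∈ l, s ∈ S := fun r hr => hl r (Multiset.mem_cons_of_mem hr)
      rw [Multiset.sum_cons, Multiset.card_cons, Nat.cast_succ, add_comm s]
      calc |u (l.sum + s)| ≤ |u l.sum| + |fwdDiff s u l.sum| := by
            simpa [fwdDiff] using abs_add_le (u l.sum) (fwdDiff s u l.sum)
        _ ≤ (|u 0| + M) * ((l.card : ℝ) + 1) ^ (j + 1) +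
              (|u 0| + M) * ((l.card : ℝ) + 1) ^ j := by
            refine add_le_add (ih hlS) ?_
            refine (h s (hl s (Multiset.mem_cons_self s l)) l.sum).trans ?_
            gcongr
            · exact le_add_of_nonneg_left (abs_nonneg _)
            · exact_mod_cast len_sum_le hlS
        _ = (|u 0| + M) * (((l.card : ℝ) + 1) ^ j * (l.card + 1 + 1)) := by ring
        _ ≤ (|u 0| + M) * ((l.card : ℝ) + 1 + 1) ^ (j + 1) := by
            rw [pow_succ]
            gcongr
            linarith
  obtain ⟨l, hl, hlS, rfl⟩ := hS.exists_multiset_card_eq_len x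
  exact hl ▸ hword l hlS

theorem abs_le_pow_of_mem_degreeLT (hS : IsSymmGen S) {j : ℕ} {u : G → ℝ}
    (hu : u ∈ degreeLT G (j + 1)) : ∃ K, ∀ x, |u x| ≤ K * ((len S x : ℝ) + 1) ^ j := by
  induction j generalizing u with
  | zero =>
    refine ⟨|u 0|, fun x => ?_⟩
    have hconst : fwdDiff x u = 0 := mem_degreeLT_succ.1 hu x
    have hx : u (0 + x) - u 0 = 0 := congrFun hconst 0
    rw [zero_add, sub_eq_zero] at hx
    simp [hx]
  | succ j ih =>
    choose K hK using fun s => ih (mem_degreeLT_succ.1 hu s)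
    set M := (S.map fun s => |K s|).sum
    have hstep : ∀ s ∈ S, ∀ x, |fwdDiff s u x| ≤ M * ((len S x : ℝ) + 1) ^ j := by
      intro s hs x
      refine (hK s x).trans ?_
      gcongr
      refine (le_abs_self _).trans (Multiset.single_le_sum ?_ _ (Multiset.mem_map_of_mem _ hs))
      simp +contextual
    have hM : 0 ≤ M := Multiset.sum_nonneg (by simp +contextual)
    exact ⟨|u 0| + M, hS.abs_le_pow_succ_of_abs_fwdDiff_le hM hstep⟩

theorem isHarmonic_fwdDiff {u : G → ℝ} (hu : IsHarmonic S u) (g : G) :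
    IsHarmonic S (fwdDiff g u) := by
  intro x
  have h : laplacian S (fwdDiff g u) x = laplacian S u (x + g) - laplacian S u x := by
    simp only [laplacian, ← Multiset.sum_map_sub, fwdDiff, add_right_comm x _ g]
    congr 2
    funext s
    ring
  rw [h, hu, hu, sub_zero]

theorem HasMeanGrowth.mem_degreeLT {u : G → ℝ} {a : ℝ} (h : HasMeanGrowth S u a)
    (hu : IsHarmonic S u) (hS : IsSymmGen S) {j : ℕ} (ha : a < j / 2) : u ∈ degreeLT G j := by
  induction j generalizing u a with
  | zero =>
    suffices u = 0 from this
    funext x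
    have ha' : 0 < -a := by simpa using ha
    have hlim : Tendsto (fun n : ℕ => (n : ℝ) ^ a) atTop (𝓝 0) := by
      simpa [Function.comp_def] using (tendsto_rpow_neg_atTop ha').comp tendsto_natCast_atTop_atTop
    refine abs_nonpos_iff.1 (ge_of_tendsto' ((h x).trans_tendsto hlim) fun n => ?_)
    simpa [stepAvg_pow_eq_self hu.stepAvg_lazyStep] using abs_stepAvg_pow_le (lazyStep S) n u x
  | succ j ih =>
    have hab : a - 1 / 2 < j / 2 := by
      push_cast at ha
      linarith
    obtain ⟨b, hb, hbj⟩ := exists_between hab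
    refine mem_degreeLT_succ_of_closure hS.gen fun s hs => ?_
    obtain ⟨k, rfl⟩ := exists_lazyStep_eq_of_mem hs
    exact ih (h.fwdDiff_lazyStep hu hS hb k) (isHarmonic_fwdDiff hu _) hbj

end Polynomial

section PolynomialGrowth

variable {G : Type*} [AddCommGroup G] {S : Multiset G}

theorem IsSymmGen.wordDist_add_one_rpow_le (hS : IsSymmGen S) {d : ℝ} (hd : 0 ≤ d) (p q x : G) :
    ((wordDist S p x : ℝ) + 1) ^ d ≤
      ((wordDist S p q : ℝ) + 1) ^ d * ((wordDist S q x : ℝ) + 1) ^ d := by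
  rw [← Real.mul_rpow (by positivity) (by positivity)]
  gcongr
  simpa only [wordDist_eq_len_sub, sub_add_sub_cancel'] using
    hS.len_add_one_le_mul (q - p) (x - q)

theorem IsHarmonic.mem_degreeLT_of_neg_le {u : G → ℝ} (hu : IsHarmonic S u) (hS : IsSymmGen S)
    {p : G} {C d : ℝ} (hd : 0 ≤ d) (h : ∀ x, -C * ((wordDist S p x : ℝ) + 1) ^ d ≤ u x) :
    u ∈ degreeLT G (⌊d⌋₊ + 1) := by
  have hlen (x : G) :
      -(|C| * ((wordDist S p 0 : ℝ) + 1) ^ d * ((len S x : ℝ) + 1) ^ d) ≤ u x := by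
    refine le_trans ?_ (h x)
    rw [neg_mul, neg_le_neg_iff, mul_assoc]
    exact mul_le_mul (le_abs_self C) (hS.wordDist_add_one_rpow_le hd p 0 x) (by positivity)
      (abs_nonneg C)
  have hfloor : d / 2 < (⌊d⌋₊ + 1 : ℕ) / 2 := by
    push_cast
    linarith [Nat.lt_floor_add_one d]
  exact (hu.hasMeanGrowth_of_neg_le hS (by positivity) hd hlen).mem_degreeLT hu hS hfloor

theorem IsSymmGen.mem_H_iff (hS : IsSymmGen S) {p : G} {d : ℝ} (hd : 0 ≤ d) {u : G → ℝ} :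
    u ∈ H S p d ↔ IsHarmonic S u ∧ u ∈ degreeLT G (⌊d⌋₊ + 1) := by
  refine and_congr_right fun hu => ⟨?_, fun hdeg => ?_⟩
  · rintro ⟨C, hC⟩
    exact hu.mem_degreeLT_of_neg_le hS hd fun x =>
      (neg_mul C _).trans_le (neg_le_of_abs_le (hC x))
  · obtain ⟨K, hK⟩ := abs_le_pow_of_mem_degreeLT hS hdeg
    have hK0 : 0 ≤ K := by simpa [len_zero] using (abs_nonneg _).trans (hK 0)
    refine ⟨K * ((wordDist S 0 p : ℝ) + 1) ^ d, fun x => (hK x).trans ?_⟩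
    rw [mul_assoc]
    gcongr
    refine le_trans ?_ (hS.wordDist_add_one_rpow_le hd 0 p x)
    rw [← Real.rpow_natCast]
    exact Real.rpow_le_rpow_of_exponent_le (by simp) (Nat.floor_le hd)

theorem IsSymmGen.HM_eq_H (hS : IsSymmGen S) (p : G) {d : ℝ} (hd : 0 ≤ d) :
    HM S p d = H S p d := by
  apply le_antisymm
  · refine Submodule.span_le.2 ?_
    rintro u ⟨hu, C, hC⟩
    exact (hS.mem_H_iff hd).2 ⟨hu, hu.mem_degreeLT_of_neg_le hS hd hC⟩
  · rintro u ⟨hu, C, hC⟩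
    exact Submodule.subset_span ⟨hu, C, fun x =>
      (neg_mul C _).trans_le (neg_le_of_abs_le (hC x))⟩

end PolynomialGrowth

section Quotient

variable {G G' : Type*} [AddCommGroup G] [AddCommGroup G'] {S : Multiset G} {f : G →+ G'}

theorem IsSymmGen.map (hS : IsSymmGen S) (hf : Function.Surjective f) : IsSymmGen (S.map f) where
  symm := by
    conv_rhs => rw [← hS.symm]
    simp
  gen := by
    have himage : {y | y ∈ S.map f} = f '' {s | s ∈ S} := by
      ext y
      simp
    rw [himage, ← AddMonoidHom.map_closure, hS.gen, AddSubgroup.map_top_of_surjective f hf]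

theorem isHarmonic_comp_iff (hf : Function.Surjective f) {g : G' → ℝ} :
    IsHarmonic S (g ∘ f) ↔ IsHarmonic (S.map f) g := by
  simp [IsHarmonic, hf.forall, laplacian]

theorem comp_mem_degreeLT_iff (hf : Function.Surjective f) {j : ℕ} {g : G' → ℝ} :
    g ∘ f ∈ degreeLT G j ↔ g ∈ degreeLT G' j := by
  induction j generalizing g with
  | zero => exact ⟨fun h => hf.injective_comp_right h, fun h => congrArg (· ∘ f) h⟩
  | succ j ih =>
    have hcomp (x : G) : fwdDiff x (g ∘ f) = fwdDiff (f x) g ∘ f := by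
      funext y
      simp [fwdDiff]
    simp only [mem_degreeLT_succ, hcomp, ih, hf.forall]

theorem exists_comp_eq_of_mem_degreeLT (hf : Function.Surjective f)
    (hker : ∀ x, f x = 0 → IsOfFinAddOrder x) {j : ℕ} {u : G → ℝ} (hu : u ∈ degreeLT G j) :
    ∃ g : G' → ℝ, g ∘ f = u := by
  refine ⟨u ∘ Function.surjInv hf, funext fun x => ?_⟩
  have ht : IsOfFinAddOrder (Function.surjInv hf (f x) - x) :=
    hker _ (by rw [map_sub, Function.surjInv_eq hf, sub_self])
  simpa using add_eq_of_mem_degreeLT hu ht x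

end Quotient

end AbelianCayley

theorem theorem1p3_general {G G' : Type*} [AddCommGroup G] [AddCommGroup G'] {S : Multiset G}
    (hS : AbelianCayley.IsSymmGen S) {f : G →+ G'} (hf : Function.Surjective f)
    (hker : ∀ x, f x = 0 → IsOfFinAddOrder x) (p : G) (p' : G') {d : ℝ} (hd : 0 ≤ d) :
    AbelianCayley.HM S p d = AbelianCayley.H S p d ∧
    AbelianCayley.H S p d = (AbelianCayley.H (S.map f) p' d).map (LinearMap.funLeft ℝ ℝ f) := by
  refine ⟨hS.HM_eq_H p hd, ?_⟩
  have hcomp (g : G' → ℝ) : g ∘ f ∈ AbelianCayley.H S p d ↔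
      g ∈ AbelianCayley.H (S.map f) p' d := by
    rw [hS.mem_H_iff hd, (hS.map hf).mem_H_iff hd, AbelianCayley.isHarmonic_comp_iff hf,
      AbelianCayley.comp_mem_degreeLT_iff hf]
  ext u
  constructor
  · intro hu
    obtain ⟨g, rfl⟩ :=
      AbelianCayley.exists_comp_eq_of_mem_degreeLT hf hker ((hS.mem_H_iff hd).1 hu).2
    exact ⟨g, (hcomp g).1 hu, rfl⟩
  · rintro ⟨g, hg, rfl⟩
    exact (hcomp g).2 hg

theorem theorem1p3 {G : Type*} [AddCommGroup G]
    -- the decomposition `G = G₁ ⊕ G₂ ≅ ℤ^m ⊕ ⨁ ℤ/(r_i ^ a_i)`, `r_i` prime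
    (G₁ G₂ : Submodule ℤ G) (h : IsCompl G₁ G₂)
    (m : ℕ) (e₁ : G₁ ≃+ (Fin m → ℤ))
    (l : ℕ) (r a : Fin l → ℕ) (hr : ∀ i, (r i).Prime)
    (e₂ : G₂ ≃+ ((i : Fin l) → ZMod (r i ^ a i)))
    -- the Cayley graph and the base points of `G` and `G₁`
    (S : Multiset G) (hS : AbelianCayley.IsSymmGen S) (p : G) (p₁ : G₁)
    (d : ℝ) (hd : 0 ≤ d) :
    AbelianCayley.HM S p d = AbelianCayley.H S p d ∧
    -- functions on `G₁` are regarded as functions on `G` through `π_{G₁}`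
    AbelianCayley.H S p d =
      (AbelianCayley.H (S.map (AbelianCayley.proj h)) p₁ d).map
        (LinearMap.funLeft ℝ ℝ (AbelianCayley.proj h)) := by
  have hpow (i : Fin l) : NeZero (r i ^ a i) := ⟨pow_ne_zero _ (hr i).ne_zero⟩
  have hfinite : Finite G₂ := Finite.of_equiv _ e₂.symm.toEquiv
  refine theorem1p3_general (f := (AbelianCayley.proj h).toAddMonoidHom) hS
    (fun y => ⟨y, Submodule.projectionOnto_apply_left h y⟩) (fun x hx => ?_) p p₁ hd
  have hx₂ : x ∈ G₂ := (Submodule.projectionOnto_apply_eq_zero_iff h).1 hx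
  exact G₂.toAddSubgroup.isOfFinAddOrder_coe.2 (isOfFinAddOrder_of_finite (⟨x, hx₂⟩ : G₂))
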